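/- Let $n\ge 0$ and let $F\subset\mathbb R^n$ be a nonempty convex cone, i.e. a nonempty set closed under addition and under multiplication by positive scalars ($F$ is not assumed closed, nor to contain $0$). A function $f(x)=\tfrac12 x^{\mathsf T}Ax+b^{\mathsf T}x+c$ with $A=A^{\mathsf T}\in\mathbb R^{n\times n}$, $b\in\mathbb R^n$, $c\in\mathbb R$ is called quadratic. Then the following are equivalent: (1) $F$ is a Frank-and-Wolfe set: every quadratic function $f$ which is bounded below on $F$ attains its infimum on $F$. (2) $F$ is a quasi-Frank-and-Wolfe set (qFW-set): $F$ is convex, and every quadratic function $f$ which is bounded below on $F$ and quasi-convex on $F$ (that is, $\{x\in F: f(x)\le\alpha\}$ is convex for every $\alpha\in\mathbb R$) attains its infimum on $F$. (3) $F$ is polyhedral: $F$ is the solution set of a finite (possibly empty) system of inequalities $\langle a_i,x\rangle\le\beta_i$ with $a_i\in\mathbb R^n$, $\beta_i\in\mathbb R$. -/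

import Mathlib

open scoped Matrix

/-- A quadratic function on `ℝⁿ`: `f x = ½ xᵀ A x + bᵀ x + c` with `A` a symmetric real matrix
(degenerate `A`, in particular `A = 0`, is allowed). -/
def IsQuadratic {n : ℕ} (f : EuclideanSpace ℝ (Fin n) → ℝ) : Prop :=
  ∃ (A : Matrix (Fin n) (Fin n) ℝ) (b : Fin n → ℝ) (c : ℝ), A.IsSymm ∧
    ∀ x : EuclideanSpace ℝ (Fin n),
      f x = (1 / 2 : ℝ) * (x.ofLp ⬝ᵥ (A *ᵥ x.ofLp)) + b ⬝ᵥ x.ofLp + c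

/-- A Frank-and-Wolfe set: every quadratic function which is bounded below on `F` attains its
infimum on `F`. -/
def IsFWSet {n : ℕ} (F : Set (EuclideanSpace ℝ (Fin n))) : Prop :=
  ∀ f : EuclideanSpace ℝ (Fin n) → ℝ, IsQuadratic f → BddBelow (f '' F) →
    ∃ x ∈ F, IsMinOn f F x

/-- A quasi-Frank-and-Wolfe set: a convex set `F` such that every quadratic function which is
quasi-convex on `F` (its sub-level sets in `F` are convex) and bounded below on `F` attains its
infimum on `F`. -/
def IsQFWSet {n : ℕ} (F : Set (EuclideanSpace ℝ (Fin n))) : Prop :=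
  Convex ℝ F ∧
    ∀ f : EuclideanSpace ℝ (Fin n) → ℝ, IsQuadratic f → QuasiconvexOn ℝ F f →
      BddBelow (f '' F) → ∃ x ∈ F, IsMinOn f F x

/-- A polyhedral set: the solution set of a finite system of (weak) affine inequalities
`⟪aᵢ, x⟫ ≤ βᵢ`, that is, a finite intersection of closed half-spaces (the empty system gives the
whole space). -/
def IsPolyhedralSet {n : ℕ} (F : Set (EuclideanSpace ℝ (Fin n))) : Prop :=
  ∃ (m : ℕ) (a : Fin m → EuclideanSpace ℝ (Fin n)) (β : Fin m → ℝ),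
    F = {x | ∀ i, inner ℝ (a i) x ≤ β i}

/-!
Polyhedral sets are Frank-and-Wolfe sets by the Frank–Wolfe theorem
(`exists_isMinOn_of_quadratic_of_bddBelow`), and convex Frank-and-Wolfe sets are
quasi-Frank-and-Wolfe sets by definition. It remains to see that a quasi-Frank-and-Wolfe cone `F` is
polyhedral.

For this, convex quadratic functions suffice. The squared distance to a translate `y + L` of a
linear subspace attains its infimum on `F`, so `F + L` is closed for every `L`
(`IsQFWSet.isClosed_add`). A convex cone with this property is finitely generated
(`PointedCone.fg_of_forall_isClosed_sup`), by induction on its lineality space: for `x` in `F`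
outside the lineality space, the cone `F + ℝx` inherits the property and has a larger lineality
space, so it is finitely generated. Hence `F` agrees near `x` with a finitely generated subcone
(`PointedCone.exists_fg_le_nhds`), and compactness of the set of unit vectors of `F` orthogonal to
the lineality space leaves finitely many generators (`PointedCone.fg_of_forall_fg_sup_span`).
Finally, a finitely generated cone is polyhedral by Fourier–Motzkin elimination
(`PointedCone.isPolyhedral_of_fg`).
-/

/-! ### The Frank–Wolfe theorem -/

open Filter Topology in
/-- **Frank–Wolfe theorem** in a finite-dimensional inner product space, for a quadratic function
given by a symmetric operator: bounded below on a nonempty polyhedral set, it attains its infimum.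
If the least-norm points of the sublevel sets did not stay bounded, they would have a limiting
direction `d`, and moving along `-d` would yield points of smaller norm in the same sublevel set. -/
theorem exists_isMinOn_of_quadratic_of_bddBelow {E : Type*} [NormedAddCommGroup E]
    [InnerProductSpace ℝ E] [FiniteDimensional ℝ E] {ι : Type*} [Finite ι] (a : ι → E) (β : ι → ℝ)
    (M : E →L[ℝ] E) (hM : M.toLinearMap.IsSymmetric) (b : E) (c : ℝ) {f : E → ℝ}
    (hf : ∀ x, f x = 1 / 2 * inner ℝ x (M x) + inner ℝ b x + c)
    (hne : {x | ∀ i, inner ℝ (a i) x ≤ β i}.Nonempty)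
    (hbdd : BddBelow (f '' {x | ∀ i, inner ℝ (a i) x ≤ β i})) :
    ∃ x ∈ {x | ∀ i, inner ℝ (a i) x ≤ β i}, IsMinOn f {x | ∀ i, inner ℝ (a i) x ≤ β i} x := by
  set F : Set E := {x | ∀ i, inner ℝ (a i) x ≤ β i} with hFdef
  have hmem : ∀ {x}, x ∈ F ↔ ∀ i, inner ℝ (a i) x ≤ β i := Iff.rfl
  have hFcl : IsClosed F := by
    rw [hFdef, Set.ofPred_forall]
    exact isClosed_iInter fun i => isClosed_le (by fun_prop) continuous_const
  have hfc : Continuous f := by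
    rw [funext hf]; fun_prop
  have hexp : ∀ x d : E, ∀ t : ℝ, f (x + t • d) =
      f x + t * (inner ℝ x (M d) + inner ℝ b d) + t ^ 2 / 2 * inner ℝ d (M d) := by
    intro x d t
    have hs : inner ℝ d (M x) = inner ℝ x (M d) := by
      rw [real_inner_comm]; exact hM x d
    simp only [hf, map_add, map_smul, inner_add_left, inner_add_right, inner_smul_left,
      inner_smul_right, hs, RCLike.conj_to_real]
    ring
  set m := sInf (f '' F) with hm
  have hmle : ∀ x ∈ F, m ≤ f x := fun x hx => csInf_le hbdd ⟨x, hx, rfl⟩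
  -- `x k` has least norm among the points of `F` at which `f` exceeds its infimum by at most
  -- `1 / (k + 1)`
  have hx : ∀ k : ℕ, ∃ x ∈ F, f x ≤ m + 1 / (k + 1) ∧
      ∀ y ∈ F, f y ≤ m + 1 / (k + 1) → ‖x‖ ≤ ‖y‖ := by
    intro k
    have hcl : IsClosed {x ∈ F | f x ≤ m + 1 / (k + 1)} :=
      hFcl.inter (isClosed_le hfc continuous_const)
    have hn : {x ∈ F | f x ≤ m + 1 / (k + 1)}.Nonempty := by
      have hlt : sInf (f '' F) < m + 1 / (k + 1) :=
        lt_add_of_pos_right m Nat.one_div_pos_of_nat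
      obtain ⟨_, ⟨x, hx, rfl⟩, hlt⟩ := exists_lt_of_csInf_lt (hne.image f) hlt
      exact ⟨x, hx, hlt.le⟩
    obtain ⟨x, hx, hd⟩ := hcl.exists_infDist_eq_dist hn 0
    refine ⟨x, hx.1, hx.2, fun y hy hy' => ?_⟩
    have := Metric.infDist_le_dist_of_mem (x := (0 : E)) (s := {x ∈ F | f x ≤ m + 1 / (k + 1)})
      (y := y) ⟨hy, hy'⟩
    rwa [hd, dist_zero_left, dist_zero_left] at this
  choose x hxF hxf hxmin using hx
  have hlim : Tendsto (fun k : ℕ => m + 1 / ((k : ℝ) + 1)) atTop (𝓝 m) := by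
    simpa using tendsto_one_div_add_atTop_nhds_zero_nat.const_add m
  by_cases hB : ∃ R, ∃ᶠ k in atTop, x k ∈ Metric.closedBall (0 : E) R
  · obtain ⟨R, hR⟩ := hB
    obtain ⟨z, -, φ, hφ, hz⟩ := tendsto_subseq_of_frequently_bounded Metric.isBounded_closedBall hR
    refine ⟨z, hFcl.mem_of_tendsto hz (Eventually.of_forall fun k => hxF _), fun y hy => ?_⟩
    exact (le_of_tendsto_of_tendsto' ((hfc.tendsto z).comp hz) (hlim.comp hφ.tendsto_atTop)
      fun k => hxf _).trans (hmle y hy)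
  · exfalso
    have hnorm : Tendsto (fun k => ‖x k‖) atTop atTop := by
      refine tendsto_atTop.2 fun R => ?_
      have : ∀ᶠ k in atTop, x k ∉ Metric.closedBall (0 : E) R := by
        rw [← not_frequently]; exact fun h => hB ⟨R, h⟩
      filter_upwards [this] with k hk
      simpa using (not_le.1 (by simpa using hk)).le
    have hsph : ∃ᶠ k in atTop, ‖x k‖⁻¹ • x k ∈ Metric.sphere (0 : E) 1 := by
      refine Eventually.frequently ?_
      filter_upwards [hnorm.eventually_gt_atTop 0] with k hk
      simp [norm_smul, hk.ne']
    obtain ⟨d, hd, φ, hφ, hdlim⟩ := (isCompact_sphere (0 : E) 1).tendsto_subseq' hsph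
    rw [mem_sphere_zero_iff_norm] at hd
    have hnφ : Tendsto (fun k => ‖x (φ k)‖) atTop atTop := hnorm.comp hφ.tendsto_atTop
    have hinv : Tendsto (fun k => ‖x (φ k)‖⁻¹) atTop (𝓝 0) := tendsto_inv_atTop_zero.comp hnφ
    have hinner : ∀ a : E,
        Tendsto (fun k => ‖x (φ k)‖⁻¹ * inner ℝ a (x (φ k))) atTop (𝓝 (inner ℝ a d)) := by
      intro a
      simpa [Function.comp_def, inner_smul_right] using
        Filter.Tendsto.inner (𝕜 := ℝ) (tendsto_const_nhds (x := a)) hdlim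
    have hdrec : ∀ i, inner ℝ (a i) d ≤ 0 := by
      intro i
      have h0 : Tendsto (fun k => ‖x (φ k)‖⁻¹ * β i) atTop (𝓝 0) := by
        simpa using hinv.mul_const (β i)
      exact le_of_tendsto_of_tendsto' (hinner (a i)) h0 fun k =>
        mul_le_mul_of_nonneg_left (hmem.1 (hxF _) i) (by positivity)
    -- the values of `f` at `x (φ k)` stay bounded, so its quadratic part is nonpositive at `d`
    have hdM : inner ℝ d (M d) ≤ 0 := by
      have h1 : Tendsto (fun k => inner ℝ (‖x (φ k)‖⁻¹ • x (φ k)) (M (‖x (φ k)‖⁻¹ • x (φ k))))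
          atTop (𝓝 (inner ℝ d (M d))) := hdlim.inner ((M.continuous.tendsto d).comp hdlim)
      have h2 : Tendsto (fun k => 2 * (‖x (φ k)‖⁻¹ * (‖x (φ k)‖⁻¹ * (m + 1 - c) -
          ‖x (φ k)‖⁻¹ * inner ℝ b (x (φ k))))) atTop (𝓝 0) := by
        simpa using (hinv.mul ((hinv.mul_const (m + 1 - c)).sub (hinner b))).const_mul 2
      refine le_of_tendsto_of_tendsto' h1 h2 fun k => ?_
      have h3 : f (x (φ k)) ≤ m + 1 := by
        refine (hxf (φ k)).trans (add_le_add_right ?_ m)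
        rw [div_le_one (by positivity)]
        linarith [(Nat.cast_nonneg (φ k) : (0 : ℝ) ≤ φ k)]
      rw [hf] at h3
      have h4 : 0 ≤ ‖x (φ k)‖⁻¹ ^ 2 := by positivity
      simp only [map_smul, inner_smul_left, inner_smul_right, RCLike.conj_to_real]
      nlinarith [mul_le_mul_of_nonneg_left h3 h4]
    -- as `f` is bounded below along the ray `y + ℝ≥0 d`, its slope there is nonnegative
    have hslope : ∀ y ∈ F, 0 ≤ inner ℝ y (M d) + inner ℝ b d := by
      intro y hy
      by_contra! hneg
      set l := inner ℝ y (M d) + inner ℝ b d with hl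
      have ht : 0 ≤ (f y - m + 1) / (-l) :=
        div_nonneg (by linarith [hmle y hy]) (by linarith)
      have hyt : y + ((f y - m + 1) / (-l)) • d ∈ F := hmem.2 fun i => by
        rw [inner_add_right, inner_smul_right]
        linarith [hmem.1 hy i, mul_nonpos_of_nonneg_of_nonpos ht (hdrec i)]
      have h1 := hmle _ hyt
      have h2 : (f y - m + 1) / (-l) * l = -(f y - m + 1) := by
        field_simp [hneg.ne]
      rw [hexp, ← hl, h2] at h1
      linarith [mul_nonpos_of_nonneg_of_nonpos
        (by positivity : 0 ≤ ((f y - m + 1) / (-l)) ^ 2 / 2) hdM]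
    -- hence moving from `x (φ k)` in the direction `-d` does not increase `f`, stays in `F`
    -- and decreases the norm
    have hev : ∀ᶠ k in atTop, x (φ k) - d ∈ F := by
      simp only [hmem]
      refine eventually_all.2 fun i => ?_
      rcases (hdrec i).lt_or_eq with hlt | heq
      · have : Tendsto (fun k => inner ℝ (a i) (x (φ k))) atTop atBot := by
          refine (hnφ.atTop_mul_neg hlt (hinner (a i))).congr' ?_
          filter_upwards [hnφ.eventually_gt_atTop 0] with k hk
          field_simp
        filter_upwards [this.eventually_le_atBot (β i + inner ℝ (a i) d)] with k hk
        rw [inner_sub_right]; linarith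
      · refine Eventually.of_forall fun k => ?_
        rw [inner_sub_right, heq, sub_zero]
        exact hmem.1 (hxF _) i
    have hdd : Tendsto (fun k => inner ℝ d (x (φ k))) atTop atTop := by
      have h1 : (0 : ℝ) < inner ℝ d d := by rw [real_inner_self_eq_norm_sq, hd]; norm_num
      refine (hnφ.atTop_mul_pos h1 (hinner d)).congr' ?_
      filter_upwards [hnφ.eventually_gt_atTop 0] with k hk
      field_simp
    obtain ⟨k, hkF, hk⟩ := (hev.and (hdd.eventually_gt_atTop 1)).exists
    have hle : f (x (φ k) - d) ≤ f (x (φ k)) := by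
      have h1 := hexp (x (φ k)) d (-1)
      rw [neg_one_smul, ← sub_eq_add_neg] at h1
      rw [h1]
      linarith [hslope _ (hxF (φ k))]
    have h2 := hxmin (φ k) _ hkF (hle.trans (hxf _))
    have h3 := norm_sub_sq_real (x (φ k)) d
    rw [hd, real_inner_comm] at h3
    nlinarith [norm_nonneg (x (φ k))]

/-! ### Finitely generated and polyhedral cones -/

/-- A pointed cone is polyhedral if it is the solution set of a finite system of homogeneous
inequalities `⟪a, x⟫ ≤ 0`. -/
def PointedCone.IsPolyhedral {E : Type*} [NormedAddCommGroup E] [InnerProductSpace ℝ E]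
    (K : PointedCone ℝ E) : Prop :=
  ∃ A : Finset E, ∀ x, x ∈ K ↔ ∀ a ∈ A, inner ℝ a x ≤ 0

namespace PointedCone

variable {E : Type*} [NormedAddCommGroup E] [InnerProductSpace ℝ E]

theorem mem_hull_insert {v : E} {s : Set E} {x : E} :
    x ∈ hull ℝ (insert v s) ↔ ∃ t : ℝ, 0 ≤ t ∧ x - t • v ∈ hull ℝ s := by
  rw [hull, Submodule.mem_span_insert]
  constructor
  · rintro ⟨t, z, hz, rfl⟩
    exact ⟨t, t.2, by
      rw [show t • v = (t : ℝ) • v from rfl, add_sub_cancel_left]; exact hz⟩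
  · rintro ⟨t, ht, hx⟩
    exact ⟨⟨t, ht⟩, _, hx, (add_sub_cancel (t • v) x).symm⟩

theorem isPolyhedral_bot [FiniteDimensional ℝ E] : (⊥ : PointedCone ℝ E).IsPolyhedral := by
  classical
  obtain ⟨S, hS⟩ := (Module.Finite.fg_top : (⊤ : Submodule ℝ E).FG)
  refine ⟨S ∪ S.image (-·), fun x => ⟨?_, fun h => ?_⟩⟩
  · intro hx a _
    rw [Submodule.mem_bot] at hx
    simp [hx]
  · have h0 : ∀ y ∈ (⊤ : Submodule ℝ E), inner ℝ y x = 0 := by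
      intro y hy
      rw [← hS] at hy
      induction hy using Submodule.span_induction with
      | mem y hy =>
        have h1 := h y (Finset.mem_union_left _ hy)
        have h2 := h (-y) (Finset.mem_union_right _ (Finset.mem_image_of_mem _ hy))
        rw [inner_neg_left] at h2
        linarith
      | zero => simp
      | add y z _ _ hy hz => rw [inner_add_left, hy, hz, add_zero]
      | smul r y _ hy => rw [inner_smul_left, hy, mul_zero]
    exact (Submodule.mem_bot _).2 (inner_self_eq_zero.1 (h0 x trivial))

/-- One step of Fourier–Motzkin elimination: the sum of a polyhedral cone and the ray spanned by `v`
is polyhedral. Each pair of inequalities with opposite signs at `v` is combined into one that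
vanishes at `v`. -/
theorem exists_forall_inner_sub_smul_nonpos (A : Finset E) (v : E) : ∃ B : Finset E, ∀ x : E,
    (∃ t : ℝ, 0 ≤ t ∧ ∀ a ∈ A, inner ℝ a (x - t • v) ≤ 0) ↔ ∀ a ∈ B, inner ℝ a x ≤ 0 := by
  classical
  refine ⟨A.filter (fun a => inner ℝ a v ≤ 0) ∪
    ((A.filter fun a => 0 < inner ℝ a v) ×ˢ (A.filter fun a => inner ℝ a v < 0)).image
      (fun q => inner ℝ q.1 v • q.2 - inner ℝ q.2 v • q.1), fun x => ⟨?_, fun h => ?_⟩⟩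
  · rintro ⟨t, ht, h⟩ a ha
    have h' : ∀ a ∈ A, inner ℝ a x ≤ t * inner ℝ a v := by
      intro a ha
      have := h a ha
      rw [inner_sub_right, inner_smul_right] at this
      linarith
    rcases Finset.mem_union.1 ha with ha | ha
    · obtain ⟨ha, hav⟩ := Finset.mem_filter.1 ha
      nlinarith [h' a ha]
    · obtain ⟨⟨p, q⟩, hpq, rfl⟩ := Finset.mem_image.1 ha
      simp only [Finset.mem_product, Finset.mem_filter] at hpq
      obtain ⟨⟨hp, hpv⟩, hq, hqv⟩ := hpq
      simp only [inner_sub_left, inner_smul_left, RCLike.conj_to_real]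
      nlinarith [mul_le_mul_of_nonneg_left (h' q hq) hpv.le,
        mul_le_mul_of_nonneg_left (h' p hp) (neg_nonneg.2 hqv.le)]
  · have h1 : ∀ a ∈ A, inner ℝ a v ≤ 0 → inner ℝ a x ≤ 0 := fun a ha hav =>
      h a (Finset.mem_union_left _ (Finset.mem_filter.2 ⟨ha, hav⟩))
    have h2 : ∀ p ∈ A, ∀ q ∈ A, 0 < inner ℝ p v → inner ℝ q v < 0 →
        inner ℝ p v * inner ℝ q x - inner ℝ q v * inner ℝ p x ≤ 0 := by
      intro p hp q hq hpv hqv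
      have := h (inner ℝ p v • q - inner ℝ q v • p) (Finset.mem_union_right _
        (Finset.mem_image.2 ⟨(p, q), by simp [hp, hq, hpv, hqv], rfl⟩))
      simpa only [inner_sub_left, inner_smul_left, RCLike.conj_to_real] using this
    -- the parameter is the largest of the lower bounds imposed by the inequalities `a ∈ A` with
    -- `0 < ⟪a, v⟫`, and `0`
    set L : Finset ℝ := insert 0
      ((A.filter fun a => 0 < inner ℝ a v).image fun a => inner ℝ a x / inner ℝ a v) with hL
    have hLne : L.Nonempty := Finset.insert_nonempty _ _
    have hmax := L.max'_mem hLne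
    refine ⟨L.max' hLne, L.le_max' 0 (Finset.mem_insert_self _ _), fun a ha => ?_⟩
    rw [inner_sub_right, inner_smul_right, sub_nonpos]
    rcases lt_trichotomy (inner ℝ a v) 0 with hav | hav | hav
    · rcases Finset.mem_insert.1 hmax with h0 | hmax
      · rw [h0, zero_mul]; exact h1 a ha hav.le
      · obtain ⟨p, hp, hpe⟩ := Finset.mem_image.1 hmax
        obtain ⟨hp, hpv⟩ := Finset.mem_filter.1 hp
        rw [← hpe, div_mul_eq_mul_div, le_div_iff₀ hpv]
        linarith [h2 p hp a ha hpv hav]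
    · rw [hav, mul_zero]; exact h1 a ha hav.le
    · rw [← div_le_iff₀ hav]
      exact L.le_max' _ (Finset.mem_insert_of_mem
        (Finset.mem_image.2 ⟨a, Finset.mem_filter.2 ⟨ha, hav⟩, rfl⟩))

/-- The **Minkowski–Weyl theorem**, in the direction proved by Weyl. -/
theorem isPolyhedral_of_fg [FiniteDimensional ℝ E] {K : PointedCone ℝ E} (hK : K.FG) :
    K.IsPolyhedral := by
  classical
  obtain ⟨S, rfl⟩ := hK
  induction S using Finset.induction_on with
  | empty => simpa using isPolyhedral_bot
  | insert v S _ ih =>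
    obtain ⟨A, hA⟩ := ih
    obtain ⟨B, hB⟩ := exists_forall_inner_sub_smul_nonpos A v
    refine ⟨B, fun x => ?_⟩
    rw [← hB, Finset.coe_insert]
    refine mem_hull_insert.trans ?_
    simp only [hA]

/-! ### Cones whose linear images are closed -/

open Topology in
/-- If `K + ℝx` is finitely generated, then near `x` the cone `K` coincides with a finitely
generated subcone `T`. Here `T` is generated by `x` and by representatives in `K`, modulo `x`, of
generators of `K + ℝx`; the inequalities of `T` that are strict at `x` hold near `x`, and the others
do not see the difference between `T` and `T + ℝx`. -/
theorem exists_fg_le_nhds [FiniteDimensional ℝ E] {K : PointedCone ℝ E} {x : E} (hx : x ∈ K)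
    (hfg : (K ⊔ (Submodule.span ℝ {x} : PointedCone ℝ E)).FG) :
    ∃ T : PointedCone ℝ E, T.FG ∧ T ≤ K ∧ ∃ U ∈ 𝓝 x, (K : Set E) ∩ U ⊆ T := by
  classical
  obtain ⟨S, hS⟩ := hfg
  have hv : ∀ s ∈ S, ∃ v ∈ K, s - v ∈ Submodule.span ℝ {x} := by
    intro s hs
    have : s ∈ K ⊔ (Submodule.span ℝ {x} : PointedCone ℝ E) := hS ▸ Submodule.subset_span hs
    obtain ⟨v, hv, r, hr, rfl⟩ := Submodule.mem_sup.1 this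
    exact ⟨v, hv, by simpa using hr⟩
  choose! v hvK hvx using hv
  set T : PointedCone ℝ E := hull ℝ (insert x (S.image v) : Finset E) with hT
  have hTfg : T.FG := ⟨_, rfl⟩
  have hTK : T ≤ K := by
    refine Submodule.span_le.2 fun y hy => ?_
    rw [Finset.mem_coe, Finset.mem_insert, Finset.mem_image] at hy
    rcases hy with rfl | ⟨s, hs, rfl⟩
    · exact hx
    · exact hvK s hs
  have hKT : K ≤ T ⊔ (Submodule.span ℝ {x} : PointedCone ℝ E) := by
    refine le_sup_left.trans (hS.ge.trans (Submodule.span_le.2 fun s hs => ?_))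
    refine Submodule.mem_sup.2 ⟨v s, Submodule.subset_span ?_, s - v s, hvx s hs, by simp⟩
    exact Finset.mem_insert_of_mem (Finset.mem_image_of_mem _ hs)
  obtain ⟨A, hA⟩ := isPolyhedral_of_fg hTfg
  have hxT : ∀ a ∈ A, inner ℝ a x ≤ 0 :=
    (hA x).1 (Submodule.subset_span (Finset.mem_insert_self _ _))
  refine ⟨T, hTfg, hTK, ⋂ a ∈ A.filter (fun a => inner ℝ a x < 0), {w | inner ℝ a w < 0}, ?_, ?_⟩
  · refine (Filter.biInter_finset_mem _).2 fun a ha => ?_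
    exact (isOpen_lt (by fun_prop) continuous_const).mem_nhds (Finset.mem_filter.1 ha).2
  · rintro w ⟨hwK, hwU⟩
    refine (hA w).2 fun a ha => ?_
    rcases (hxT a ha).lt_or_eq with hlt | heq
    · exact (Set.mem_iInter₂.1 hwU a (Finset.mem_filter.2 ⟨ha, hlt⟩)).le
    · -- an inequality that is tight at `x` is insensitive to multiples of `x`
      obtain ⟨g, hg, r, hr, rfl⟩ := Submodule.mem_sup.1 (hKT hwK)
      obtain ⟨c, rfl⟩ := Submodule.mem_span_singleton.1 (show r ∈ Submodule.span ℝ {x} from hr)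
      rw [inner_add_right, inner_smul_right, heq, mul_zero, add_zero]
      exact (hA g).1 hg a ha

open Topology in
/-- If `K` is closed and `K + ℝx` is finitely generated for all `x` in `K` outside the lineality
space, then `K` is finitely generated. Modulo its lineality space, `K` is generated by its unit
vectors orthogonal to that space; these form a compact set, which finitely many finitely generated
subcones cover. -/
theorem fg_of_forall_fg_sup_span [FiniteDimensional ℝ E] {K : PointedCone ℝ E}
    (hK : IsClosed (K : Set E))
    (h : ∀ x ∈ K, x ∉ K.lineal → (K ⊔ (Submodule.span ℝ {x} : PointedCone ℝ E)).FG) : K.FG := by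
  set C : Set E := ((K : Set E) ∩ K.linealᗮ) ∩ Metric.sphere 0 1 with hC
  have hCc : IsCompact C :=
    (isCompact_sphere 0 1).inter_left (hK.inter K.lineal.isClosed_orthogonal)
  have hcov : ∃ T : PointedCone ℝ E, T.FG ∧ T ≤ K ∧ C ⊆ T := by
    refine hCc.induction_on (p := fun t => ∃ T : PointedCone ℝ E, T.FG ∧ T ≤ K ∧ t ⊆ T)
      ⟨⊥, Submodule.fg_bot, bot_le, Set.empty_subset _⟩ ?_ ?_ ?_
    · rintro s t hst ⟨T, hT, hTK, ht⟩
      exact ⟨T, hT, hTK, hst.trans ht⟩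
    · rintro s t ⟨T, hT, hTK, hs⟩ ⟨T', hT', hTK', ht⟩
      exact ⟨T ⊔ T', hT.sup hT', sup_le hTK hTK', Set.union_subset
        (hs.trans (SetLike.coe_subset_coe.2 le_sup_left))
        (ht.trans (SetLike.coe_subset_coe.2 le_sup_right))⟩
    · rintro x ⟨⟨hxK, hxN⟩, hx1⟩
      have hxl : x ∉ K.lineal := by
        intro hl
        have h0 : x = 0 := inner_self_eq_zero.1 ((Submodule.mem_orthogonal _ _).1 hxN x hl)
        simp [h0] at hx1
      obtain ⟨T, hT, hTK, U, hU, hUT⟩ := exists_fg_le_nhds hxK (h x hxK hxl)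
      exact ⟨C ∩ U, Filter.inter_mem self_mem_nhdsWithin (mem_nhdsWithin_of_mem_nhds hU),
        T, hT, hTK, fun y hy => hUT ⟨hy.1.1.1, hy.2⟩⟩
  obtain ⟨T, hT, hTK, hCT⟩ := hcov
  have hN : (K.lineal : PointedCone ℝ E).FG :=
    Submodule.FG.restrictScalars (IsNoetherian.noetherian K.lineal)
  suffices hKe : K = T ⊔ (K.lineal : PointedCone ℝ E) by
    rw [hKe]; exact hT.sup hN
  refine le_antisymm (fun w hw => ?_) (sup_le hTK K.lineal_le)
  obtain ⟨y, hy, z, hz, rfl⟩ := K.lineal.exists_add_mem_mem_orthogonal w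
  have hzK : z ∈ K := by
    have := K.add_mem hw (mem_lineal.1 hy).2
    rwa [add_neg_cancel_comm] at this
  have hzT : z ∈ T := by
    rcases eq_or_ne z 0 with rfl | hz0
    · exact T.zero_mem
    · have hn : 0 < ‖z‖ := norm_pos_iff.2 hz0
      have : ‖z‖⁻¹ • z ∈ T := hCT ⟨⟨K.smul_mem (inv_nonneg.2 hn.le) hzK,
        K.linealᗮ.smul_mem _ hz⟩, by simp [norm_smul, hn.ne']⟩
      rwa [T.smul_mem_iff (inv_pos.2 hn)] at this
  exact Submodule.mem_sup.2 ⟨z, hzT, y, hy, add_comm _ _⟩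

/-- A form of **Mirkil's theorem**: a convex cone whose sums with all linear subspaces are closed
(equivalently, all of whose linear images are closed) is finitely generated. -/
theorem fg_of_forall_isClosed_sup [FiniteDimensional ℝ E] (K : PointedCone ℝ E)
    (h : ∀ L : Submodule ℝ E, IsClosed ((K ⊔ (L : PointedCone ℝ E) : PointedCone ℝ E) : Set E)) :
    K.FG := by
  -- induction on the lineality space, which is strictly larger for `K + ℝx` than for `K` when
  -- `x ∈ K` lies outside it
  induction hN : K.lineal using WellFoundedGT.induction generalizing K with
  | ind N ih =>
    subst hN
    refine fg_of_forall_fg_sup_span (by simpa using h ⊥) fun x hx hxl => ?_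
    refine ih _ ?_ _ (fun L => ?_) rfl
    · refine lt_of_le_of_ne (fun y hy => ?_) fun he => hxl ?_
      · exact ⟨Submodule.mem_sup_left (mem_lineal.1 hy).1,
          Submodule.mem_sup_left (mem_lineal.1 hy).2⟩
      · rw [he]
        have hxs := Submodule.mem_span_singleton_self (R := ℝ) x
        exact ⟨Submodule.mem_sup_left hx,
          Submodule.mem_sup_right (show -x ∈ Submodule.span ℝ {x} from neg_mem hxs)⟩
    · rw [sup_assoc, ← ofSubmodule_sup]
      exact h _

end PointedCone

/-! ### Quadratic functions on Euclidean space -/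

/-- Quadratic functions in coordinate-free form, with a symmetric operator in place of a symmetric
matrix. -/
theorem isQuadratic_iff_exists_clm {n : ℕ} {f : EuclideanSpace ℝ (Fin n) → ℝ} :
    IsQuadratic f ↔ ∃ (M : EuclideanSpace ℝ (Fin n) →L[ℝ] EuclideanSpace ℝ (Fin n))
      (b : EuclideanSpace ℝ (Fin n)) (c : ℝ), M.toLinearMap.IsSymmetric ∧
        ∀ x, f x = 1 / 2 * inner ℝ x (M x) + inner ℝ b x + c := by
  constructor
  · rintro ⟨A, b, c, hA, hf⟩
    refine ⟨Matrix.toEuclideanCLM (n := Fin n) (𝕜 := ℝ) A, WithLp.toLp 2 b, c, ?_, fun x => ?_⟩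
    · exact Matrix.isSymmetric_toEuclideanLin_iff.2 (by simpa using! hA)
    · rw [hf, Matrix.inner_toEuclideanCLM]
      simp [EuclideanSpace.inner_eq_star_dotProduct, dotProduct_comm]
  · rintro ⟨M, b, c, hM, hf⟩
    obtain ⟨A, rfl⟩ : ∃ A, Matrix.toEuclideanCLM (n := Fin n) (𝕜 := ℝ) A = M :=
      EquivLike.surjective _ M
    refine ⟨A, b.ofLp, c, ?_, fun x => ?_⟩
    · simpa using! Matrix.isSymmetric_toEuclideanLin_iff.1 hM
    · rw [hf, Matrix.inner_toEuclideanCLM]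
      simp [EuclideanSpace.inner_eq_star_dotProduct, dotProduct_comm]

theorem isQuadratic_norm_starProjection_sub_sq {n : ℕ}
    (L : Submodule ℝ (EuclideanSpace ℝ (Fin n))) (y : EuclideanSpace ℝ (Fin n)) :
    IsQuadratic fun x => ‖L.starProjection (x - y)‖ ^ 2 := by
  have hP : ∀ u v, inner ℝ (L.starProjection u) (L.starProjection v) =
      inner ℝ u (L.starProjection v) := by
    intro u v
    rw [Submodule.inner_starProjection_left_eq_right, Submodule.starProjection_eq_self_iff.2
      (L.starProjection_apply_mem v)]
  refine isQuadratic_iff_exists_clm.2 ⟨(2 : ℝ) • L.starProjection, -(2 : ℝ) • L.starProjection y,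
    ‖L.starProjection y‖ ^ 2, fun u v => ?_, fun x => ?_⟩
  · simp [inner_smul_left, inner_smul_right, Submodule.inner_starProjection_left_eq_right]
  · rw [map_sub, norm_sub_sq_real, ← real_inner_self_eq_norm_sq (L.starProjection x), hP, hP,
      smul_apply, inner_smul_right, inner_smul_left, real_inner_comm x]
    simp only [RCLike.conj_to_real]
    ring

/-! ### Frank-and-Wolfe sets and polyhedral cones -/

theorem IsPolyhedralSet.isFWSet {n : ℕ} {F : Set (EuclideanSpace ℝ (Fin n))}
    (hF : IsPolyhedralSet F) (hne : F.Nonempty) : IsFWSet F := by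
  obtain ⟨m, a, β, rfl⟩ := hF
  intro f hf hbdd
  obtain ⟨M, b, c, hM, hf⟩ := isQuadratic_iff_exists_clm.1 hf
  exact exists_isMinOn_of_quadratic_of_bddBelow a β M hM b c hf hne hbdd

theorem IsFWSet.isQFWSet {n : ℕ} {F : Set (EuclideanSpace ℝ (Fin n))} (hF : IsFWSet F)
    (hconv : Convex ℝ F) : IsQFWSet F :=
  ⟨hconv, fun f hf _ hbdd => hF f hf hbdd⟩

/-- The sum of a quasi-Frank-and-Wolfe set `F` and a linear subspace `L` is closed. The squared
distance to `y + L` is a convex quadratic function, and if `y` is a limit of points of `F + L`, its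
infimum on `F` is zero; a point at which it is attained lies in `y + L`. -/
theorem IsQFWSet.isClosed_add {n : ℕ} {F : Set (EuclideanSpace ℝ (Fin n))} (hF : IsQFWSet F)
    (L : Submodule ℝ (EuclideanSpace ℝ (Fin n))) : IsClosed {y | ∃ x ∈ F, y - x ∈ L} := by
  refine isClosed_of_closure_subset fun y hy => ?_
  set P := Lᗮ.starProjection with hP
  have hker : ∀ z, P z = 0 ↔ z ∈ L := fun z => by
    rw [hP, Submodule.starProjection_apply_eq_zero_iff, Submodule.orthogonal_orthogonal]
  have hconv : ConvexOn ℝ F fun x => ‖P (x - y)‖ ^ 2 := by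
    have h1 : ConvexOn ℝ Set.univ fun x => ‖P (x - y)‖ := by
      simpa [Function.comp_def, sub_eq_add_neg] using
        ((convexOn_univ_norm (E := EuclideanSpace ℝ (Fin n))).comp_linearMap
          P.toLinearMap).translate_left (-y)
    exact (h1.pow (fun _ _ => norm_nonneg _) 2).subset (Set.subset_univ _) hF.1
  obtain ⟨x, hx, hmin⟩ := hF.2 _ (isQuadratic_norm_starProjection_sub_sq Lᗮ y)
    hconv.quasiconvexOn ⟨0, by rintro _ ⟨x, -, rfl⟩; positivity⟩
  refine ⟨x, hx, (hker _).1 ?_⟩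
  -- the infimum is zero, because `y` is a limit of points of `F + L`
  by_contra hne
  have hpos : 0 < ‖P (y - x)‖ := norm_pos_iff.2 hne
  obtain ⟨z, ⟨w, hw, hwz⟩, hz⟩ := Metric.mem_closure_iff.1 hy _ hpos
  have h1 : P (w - y) = P (z - y) := by
    rw [← sub_eq_zero, ← map_sub, hker, ← neg_mem_iff]
    convert hwz using 1; abel
  have h2 : ‖P (w - y)‖ ≤ dist y z := by
    rw [h1, dist_comm, dist_eq_norm]
    exact Lᗮ.norm_starProjection_apply_le _
  have h3 : ‖P (x - y)‖ ^ 2 ≤ ‖P (w - y)‖ ^ 2 := hmin hw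
  rw [← neg_sub y x, map_neg, norm_neg] at h3
  have h4 := pow_le_pow_iff_left₀ (norm_nonneg _) (norm_nonneg _) two_ne_zero |>.1 h3
  linarith

theorem ConvexCone.pointed_of_isClosed {E : Type*} [NormedAddCommGroup E] [NormedSpace ℝ E]
    {F : ConvexCone ℝ E} (hcl : IsClosed (F : Set E)) (hne : (F : Set E).Nonempty) :
    F.Pointed := by
  obtain ⟨x, hx⟩ := hne
  have h := (tendsto_one_div_add_atTop_nhds_zero_nat (𝕜 := ℝ)).smul_const x
  rw [zero_smul] at h
  exact hcl.mem_of_tendsto h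
    (Filter.Eventually.of_forall fun k => F.smul_mem Nat.one_div_pos_of_nat hx)

theorem PointedCone.IsPolyhedral.isPolyhedralSet {n : ℕ}
    {K : PointedCone ℝ (EuclideanSpace ℝ (Fin n))} (hK : K.IsPolyhedral) :
    IsPolyhedralSet (K : Set (EuclideanSpace ℝ (Fin n))) := by
  obtain ⟨A, hA⟩ := hK
  refine ⟨A.card, fun i => A.equivFin.symm i, fun _ => 0, ?_⟩
  ext x
  rw [SetLike.mem_coe, hA]
  refine ⟨fun h i => h _ (A.equivFin.symm i).2, fun h a ha => ?_⟩
  simpa using h (A.equivFin ⟨a, ha⟩)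

theorem IsQFWSet.isPolyhedralSet {n : ℕ} {F : ConvexCone ℝ (EuclideanSpace ℝ (Fin n))}
    (hF : IsQFWSet (F : Set (EuclideanSpace ℝ (Fin n))))
    (hne : (F : Set (EuclideanSpace ℝ (Fin n))).Nonempty) :
    IsPolyhedralSet (F : Set (EuclideanSpace ℝ (Fin n))) := by
  have hcl : IsClosed (F : Set (EuclideanSpace ℝ (Fin n))) := by
    convert hF.isClosed_add ⊥ using 1
    ext y
    simp [sub_eq_zero]
  have hp := ConvexCone.pointed_of_isClosed hcl hne
  refine PointedCone.IsPolyhedral.isPolyhedralSet (K := F.toPointedCone hp) ?_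
  refine PointedCone.isPolyhedral_of_fg (PointedCone.fg_of_forall_isClosed_sup _ fun L => ?_)
  refine (congrArg IsClosed (Set.ext fun y => ?_)).mpr (hF.isClosed_add L)
  rw [SetLike.mem_coe, Submodule.mem_sup]
  constructor
  · rintro ⟨x, hx, z, hz, rfl⟩
    refine ⟨x, hx, ?_⟩
    rw [add_sub_cancel_left]
    exact hz
  · rintro ⟨x, hx, hz⟩
    exact ⟨x, hx, y - x, hz, add_sub_cancel _ _⟩

theorem mainTheorem3 (n : ℕ) (F : ConvexCone ℝ (EuclideanSpace ℝ (Fin n)))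
    (hF : (F : Set (EuclideanSpace ℝ (Fin n))).Nonempty) :
    List.TFAE
      [IsFWSet (F : Set (EuclideanSpace ℝ (Fin n))),
       IsQFWSet (F : Set (EuclideanSpace ℝ (Fin n))),
       IsPolyhedralSet (F : Set (EuclideanSpace ℝ (Fin n)))] := by
  tfae_have 1 → 2 := fun h => h.isQFWSet F.convex
  tfae_have 2 → 3 := fun h => h.isPolyhedralSet hF
  tfae_have 3 → 1 := fun h => h.isFWSet hF
  tfae_finish
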